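/- Corollary (Round-Robin with Restart). Let $n\ge 3$, let $G$ be the cycle graph on $n$ vertices, let $c$ be the real number with $c\log n=\lfloor n^{0.4}\rfloor$ ($\log$ is the natural logarithm), and put $L=\lfloor c\log n\rfloor=\lfloor n^{0.4}\rfloor$. The vertices of $G$ are $n$ bins, all empty at the start, and $n$ balls are inserted at the times $t=0,1,\dots,n-1$ by the following scheme. *Walkers.* Two walkers move on $G$. At time $0$ they are placed independently on uniformly random directed edges of $G$; the position $W_j(t)$ of walker $j$ is the head of its current directed edge, so the two initial positions are independent uniform vertices. At each time $t\ge 1$ each walker, having last traversed the directed edge $(u,v)$, proposes to move to a uniformly random neighbour of $v$ other than $u$ (on a cycle there is exactly one), that is, to make a non-backtracking step. If one of the proposed vertices was already visited by at least one of the walkers since the last restart (the initial placement counting as a restart), or if the last restart was at time $t-L$, then the proposals are discarded and a restart happens at time $t$: both walkers are placed on fresh independent uniformly random directed edges, and the record of visited vertices starts anew. Otherwise both walkers make the proposed step. *Allocation.* At each time $t\in\{0,\dots,n-1\}$ one ball is put into whichever of the bins $W_1(t)$, $W_2(t)$ currently contains fewer balls; ties are broken by an arbitrary deterministic rule, which may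 depend on $t$ and on the history of the walkers and of the loads up to time $t$. Then, with high probability, the maximum load after all $n$ balls have been inserted is less than $\log_2\log n+O(1)$. That is, there is an absolute constant $C$ such that for every $\varepsilon>0$ there is an $N$ such that for all $n\ge\max(N,3)$ and all tie-breaking rules, $$\Pr\bigl(\text{maximum load}<\log_2\log n+C\bigr)\ge 1-\varepsilon .$$ -/

import Mathlib

open MeasureTheory ProbabilityTheory SimpleGraph

namespace RandomWalkAllocation

/-- Every set of directed edges is an event. -/
instance {V : Type*} (G : SimpleGraph V) : MeasurableSpace G.Dart := ⊤

instance {V : Type*} (G : SimpleGraph V) : DiscreteMeasurableSpace G.Dart := ⟨fun _ => trivial⟩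

section Graph

variable {V : Type*} [Fintype V] [LinearOrder V] (G : SimpleGraph V) [DecidableRel G.Adj]

/-- In a `k`-regular graph, the head of a directed edge has `k - 1` neighbours other than the
tail. -/
theorem card_forward {G : SimpleGraph V} [DecidableRel G.Adj] {k : ℕ}
    (hG : G.IsRegularOfDegree k) (e : G.Dart) :
    ((G.neighborFinset e.snd).erase e.fst).card = k - 1 := by
  have h : e.fst ∈ G.neighborFinset e.snd := by
    rw [mem_neighborFinset]
    exact e.adj.symm
  rw [Finset.card_erase_of_mem h, card_neighborFinset_eq_degree, hG.degree_eq]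

/-- One non-backtracking step. From the directed edge `e = (j, i)`, move to the directed edge
`(i, i')` where `i'` is the `l`-th neighbour of `i`, in increasing order, among the neighbours
other than `j` (the ranks `l` are counted from `0`). -/
def advance {G : SimpleGraph V} [DecidableRel G.Adj] {k : ℕ}
    (hG : G.IsRegularOfDegree k) (e : G.Dart) (l : Fin (k - 1)) : G.Dart where
  fst := e.snd
  snd := ((G.neighborFinset e.snd).erase e.fst).orderEmbOfFin (card_forward hG e) l
  adj := by
    have h := Finset.orderEmbOfFin_mem _ (card_forward hG e) l
    rw [Finset.mem_erase, mem_neighborFinset] at h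
    exact h.2

/-- The random input of one time step: for each of the two walkers, the directed edge to which the
walker is reset if a restart happens, and the rank of the neighbour to which it moves otherwise. -/
abbrev Input {V : Type*} (G : SimpleGraph V) (k : ℕ) : Type _ :=
  (Fin 2 → G.Dart) × (Fin 2 → Fin (k - 1))

/-- The law of the inputs at the times `0, 1, 2, …`: they are independent, and each is uniform on
the finite set `Input G k`. Hence all the directed edges and all the ranks in them are mutually
independent and uniform. -/
noncomputable def inputLaw {V : Type*} (G : SimpleGraph V) (k : ℕ) : Measure (ℕ → Input G k) :=
  Measure.infinitePi fun _ => uniformOn Set.univ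

/-- The state of the two walkers. -/
@[ext]
structure WalkState {V : Type*} (G : SimpleGraph V) where
  /-- The directed edge last traversed by each walker, whose head is the walker's position. -/
  edge : Fin 2 → G.Dart
  /-- The vertices visited by at least one walker since the last restart. -/
  visited : Finset V
  /-- The number of time steps since the last restart. -/
  age : ℕ

/-- The position of walker `j`. -/
def WalkState.pos {V : Type*} {G : SimpleGraph V} (s : WalkState G) (j : Fin 2) : V :=
  (s.edge j).snd

/-- The state just after the walkers have been placed on the directed edges `r 0` and `r 1`. -/
def freshState {V : Type*} [DecidableEq V] {G : SimpleGraph V} (r : Fin 2 → G.Dart) :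
    WalkState G where
  edge := r
  visited := {(r 0).snd, (r 1).snd}
  age := 0

/-- A restart takes place instead of the next step if that step would take some walker to a vertex
already visited by one of the walkers since the last restart, or if otherwise `L` time steps would
have passed since the last restart. -/
def MustRestart {G : SimpleGraph V} [DecidableRel G.Adj] {k : ℕ} (hG : G.IsRegularOfDegree k)
    (L : ℕ) (s : WalkState G) (d : Fin 2 → Fin (k - 1)) : Prop :=
  (∃ j, (advance hG (s.edge j) (d j)).snd ∈ s.visited) ∨ s.age + 1 = L

/-- The state of the walkers after both have made one step without a restart. -/
def stepState {G : SimpleGraph V} [DecidableRel G.Adj] {k : ℕ} (hG : G.IsRegularOfDegree k)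
    (s : WalkState G) (d : Fin 2 → Fin (k - 1)) : WalkState G where
  edge j := advance hG (s.edge j) (d j)
  visited := s.visited ∪ {(advance hG (s.edge 0) (d 0)).snd, (advance hG (s.edge 1) (d 1)).snd}
  age := s.age + 1

open Classical in
/-- The state of the walkers at each time, when restarts happen upon an intersection of the paths
or after `L` time steps. -/
noncomputable def walk {G : SimpleGraph V} [DecidableRel G.Adj] {k : ℕ}
    (hG : G.IsRegularOfDegree k) (L : ℕ) (ω : ℕ → Input G k) : ℕ → WalkState G
  | 0 => freshState (ω 0).1
  | t + 1 =>
    if MustRestart hG L (walk hG L ω t) (ω (t + 1)).2 then freshState (ω (t + 1)).1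
    else stepState hG (walk hG L ω t) (ω (t + 1)).2

/-- A deterministic rule for breaking ties: it names a walker, depending on the time `t` and the
states of the walkers at the times `0, …, t`. These determine the loads at time `t` as well. -/
abbrev TieRule {V : Type*} (G : SimpleGraph V) : Type _ :=
  (t : ℕ) → (Fin (t + 1) → WalkState G) → Fin 2

/-- The bin that receives the ball at time `t` if the current loads are `q`: the less loaded of the
two bins at which the walkers are, ties being broken by the rule `τ`. -/
def chosenBin {V : Type*} {G : SimpleGraph V} (τ : TieRule G) (w : ℕ → WalkState G) (t : ℕ)
    (q : V → ℕ) : V :=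
  if q ((w t).pos 0) < q ((w t).pos 1) then (w t).pos 0
  else if q ((w t).pos 1) < q ((w t).pos 0) then (w t).pos 1
  else (w t).pos (τ t fun s => w s)

/-- `load τ w t v` is the number of balls in bin `v` after the insertions at the times
`0, …, t - 1`, when the walkers move along `w`. -/
def load {V : Type*} [DecidableEq V] {G : SimpleGraph V} (τ : TieRule G) (w : ℕ → WalkState G) :
    ℕ → V → ℕ
  | 0 => 0
  | t + 1 => load τ w t + Pi.single (chosenBin τ w t (load τ w t)) 1

/-- The maximum load once as many balls as there are bins have been inserted. -/
noncomputable def maxLoad {G : SimpleGraph V} [DecidableRel G.Adj] {k : ℕ}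
    (hG : G.IsRegularOfDegree k) (L : ℕ) (τ : TieRule G) (ω : ℕ → Input G k) : ℕ :=
  Finset.univ.sup (load τ (walk hG L ω) (Fintype.card V))

end Graph

/-- A cycle graph on at least three vertices is `2`-regular. -/
theorem cycleGraph_regular {n : ℕ} (hn : 3 ≤ n) : (cycleGraph n).IsRegularOfDegree 2 := by
  obtain ⟨m, rfl⟩ := Nat.exists_eq_add_of_le' hn
  intro v
  exact cycleGraph_degree_three_le

end RandomWalkAllocation

/-! On a cycle the non-backtracking step is a permutation of the directed edges. The course of an
epoch (the time between two restarts) is thus fixed by the two edges drawn at its start, and at each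
step of the full trajectories the two positions are independent and uniform. Within an epoch no step
leads to a visited vertex, so the walkers only see loads as they were at its start (`exists_epoch`).

Hence the bins of load above `h` are at most as many as the pairs (epoch, step) at which both
walkers are in bins that had load at least `h` when the epoch began. If such bins have density at
most `γ`, a full epoch of `L` steps has at most `L * γ ^ 2` such steps on average. Two trajectories
meet with probability at most `L ^ 2 / n`, so with high probability there are only `O(n / L)` epochs
(`measureReal_card_restarts_le`). A Chernoff bound over epochs then turns density `γ` at level `h`
into `12 * γ ^ 2` at level `h + 1` (`measureReal_highBins_succ_le`).

Squaring doubles the exponent of the density, so about `log₂ log n` levels lead from a constant to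
`n ^ (-0.56) / 12`. One more level is then empty with high probability
(`measureReal_highBins_nonempty_le`). -/

namespace RandomWalkAllocation

/-! ### Non-backtracking trajectories in a 2-regular graph -/

section Trajectories

variable {V : Type*} [Fintype V] [LinearOrder V] {G : SimpleGraph V} [DecidableRel G.Adj]
  (hG : G.IsRegularOfDegree 2)

/-- The only non-backtracking continuation of a directed edge of a `2`-regular graph. -/
def nextDart (e : G.Dart) : G.Dart := advance hG e ⟨0, Nat.one_pos⟩

theorem advance_eq_nextDart (e : G.Dart) (l : Fin (2 - 1)) : advance hG e l = nextDart hG e := by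
  have : l = ⟨0, Nat.one_pos⟩ := Fin.ext (by have := l.isLt; omega)
  rw [this, nextDart]

theorem nextDart_fst (e : G.Dart) : (nextDart hG e).fst = e.snd := rfl

theorem nextDart_snd_ne (e : G.Dart) : (nextDart hG e).snd ≠ e.fst := by
  have h := Finset.orderEmbOfFin_mem _ (card_forward hG e) ⟨0, Nat.one_pos⟩
  exact (Finset.mem_erase.1 h).1

/-- Two edges with the same head, different tails and a common continuation would give their head
three neighbours. -/
theorem nextDart_injective : Function.Injective (nextDart hG) := by
  intro e e' h
  have hs : e.snd = e'.snd := by rw [← nextDart_fst hG, h, nextDart_fst]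
  have hf : e.fst = e'.fst := by
    by_contra hne
    have h1 : (nextDart hG e).snd ≠ e'.fst := by rw [h]; exact nextDart_snd_ne hG e'
    have hsub : ({e.fst, e'.fst, (nextDart hG e).snd} : Finset V) ⊆ G.neighborFinset e.snd := by
      intro x hx
      simp only [Finset.mem_insert, Finset.mem_singleton] at hx
      rw [mem_neighborFinset]
      rcases hx with rfl | rfl | rfl
      · exact e.adj.symm
      · rw [hs]; exact e'.adj.symm
      · exact (nextDart hG e).adj
    have := Finset.card_le_card hsub
    rw [Finset.card_eq_three.2 ⟨_, _, _, hne, (nextDart_snd_ne hG e).symm, h1.symm, rfl⟩,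
      card_neighborFinset_eq_degree, hG.degree_eq] at this
    omega
  exact Dart.ext _ _ (Prod.ext hf hs)

/-- The vertex reached after `i` non-backtracking steps from the directed edge `e`. -/
def headAt (e : G.Dart) (i : ℕ) : V := ((nextDart hG)^[i] e).snd

theorem card_dart_snd_mem (hG : G.IsRegularOfDegree 2) (S : Finset V) :
    (Finset.univ.filter fun e : G.Dart => e.snd ∈ S).card = 2 * S.card := by
  have h1 : ∀ v, (Finset.univ.filter fun e : G.Dart => e.snd = v).card = 2 := by
    intro v
    rw [← hG.degree_eq v, ← dart_fst_fiber_card_eq_degree]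
    refine Finset.card_bij (fun e _ => e.symm) ?_ ?_ ?_
    · intro e he
      simpa using he
    · intro a _ b _ hab
      exact Dart.symm_involutive.injective hab
    · intro b hb
      exact ⟨b.symm, by simpa using hb, by simp⟩
  rw [Finset.card_eq_sum_card_fiberwise (f := fun e : G.Dart => e.snd) (t := S)
    (fun e he => by simpa using he)]
  rw [Finset.sum_congr rfl (g := fun _ => 2), Finset.sum_const, smul_eq_mul, mul_comm]
  intro v hv
  rw [← h1 v, Finset.filter_filter]
  congr 1
  ext e
  simp only [Finset.mem_filter, Finset.mem_univ, true_and, and_iff_right_iff_imp]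
  rintro rfl
  exact hv

/-- After any number of steps from a uniform directed edge, the position is uniform. -/
theorem card_headAt_mem (i : ℕ) (S : Finset V) :
    (Finset.univ.filter fun e : G.Dart => headAt hG e i ∈ S).card = 2 * S.card := by
  rw [← card_dart_snd_mem hG S]
  have hb : Function.Bijective ((nextDart hG)^[i]) :=
    Finite.injective_iff_bijective.1 ((nextDart_injective hG).iterate i)
  refine Finset.card_bij (fun e _ => (nextDart hG)^[i] e) ?_ ?_ ?_
  · intro e he
    exact Finset.mem_filter.2 ⟨Finset.mem_univ _, (Finset.mem_filter.1 he).2⟩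
  · intro a _ b _ hab
    exact hb.1 hab
  · intro b hb'
    obtain ⟨a, rfl⟩ := hb.2 b
    exact ⟨a, Finset.mem_filter.2 ⟨Finset.mem_univ _, (Finset.mem_filter.1 hb').2⟩, rfl⟩

theorem card_dart (hG : G.IsRegularOfDegree 2) : Fintype.card G.Dart = 2 * Fintype.card V := by
  have := card_dart_snd_mem hG Finset.univ
  simpa using this

end Trajectories

/-! ### Deterministic facts about loads -/

section Loads

variable {V : Type*} {G : SimpleGraph V}

theorem chosenBin_congr {τ : TieRule G} {w w' : ℕ → WalkState G} {t : ℕ} (h : ∀ s ≤ t, w s = w' s)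
    (q : V → ℕ) : chosenBin τ w t q = chosenBin τ w' t q := by
  have h' : (fun s : Fin (t + 1) => w s) = fun s : Fin (t + 1) => w' s :=
    funext fun s => h s (Nat.lt_succ_iff.1 s.isLt)
  simp only [chosenBin, h t le_rfl, h']

theorem exists_chosenBin_eq_pos (τ : TieRule G) (w : ℕ → WalkState G) (t : ℕ) (q : V → ℕ) :
    ∃ j, chosenBin τ w t q = (w t).pos j := by
  unfold chosenBin
  split_ifs <;> exact ⟨_, rfl⟩

theorem apply_chosenBin_le (τ : TieRule G) (w : ℕ → WalkState G) (t : ℕ) (q : V → ℕ) (j : Fin 2) :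
    q (chosenBin τ w t q) ≤ q ((w t).pos j) := by
  have key : ∀ i j, q ((w t).pos 0) = q ((w t).pos 1) → q ((w t).pos i) ≤ q ((w t).pos j) := by
    intro i j h
    fin_cases i <;> fin_cases j <;> simp [h]
  unfold chosenBin
  split_ifs with h1 h2
  · fin_cases j
    · exact le_rfl
    · exact h1.le
  · fin_cases j
    · exact h2.le
    · exact le_rfl
  · exact key _ _ (le_antisymm (not_lt.1 h2) (not_lt.1 h1))

variable [DecidableEq V]

theorem load_congr {τ : TieRule G} {w w' : ℕ → WalkState G} {t : ℕ} (h : ∀ s < t, w s = w' s) :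
    load τ w t = load τ w' t := by
  induction t with
  | zero => rfl
  | succ t ih =>
    simp only [load, ih fun s hs => h s (hs.trans t.lt_succ_self),
      chosenBin_congr (fun s hs => h s (Nat.lt_succ_of_le hs))]

theorem load_succ_of_ne {τ : TieRule G} {w : ℕ → WalkState G} {t : ℕ} {v : V}
    (h : ∀ j, (w t).pos j ≠ v) : load τ w (t + 1) v = load τ w t v := by
  obtain ⟨j, hj⟩ := exists_chosenBin_eq_pos τ w t (load τ w t)
  have : v ≠ chosenBin τ w t (load τ w t) := by rw [hj]; exact (h j).symm
  simp [load, Pi.single_eq_of_ne this]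

variable [Fintype V]

/-- The bins of load at least `h`. -/
def highBins (q : V → ℕ) (h : ℕ) : Finset V := Finset.univ.filter fun v => h ≤ q v

/-- Each such bin is charged to the insertion that raised its load from `h` to `h + 1`. -/
theorem card_highBins_succ_le (τ : TieRule G) (w : ℕ → WalkState G) (h t : ℕ) :
    (highBins (load τ w t) (h + 1)).card ≤
      ((Finset.range t).filter fun s => h ≤ load τ w s (chosenBin τ w s (load τ w s))).card := by
  induction t with
  | zero => simp [highBins, load]
  | succ t ih =>
    rw [Finset.range_add_one, Finset.filter_insert]
    set b := chosenBin τ w t (load τ w t) with hb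
    split_ifs with hh
    · rw [Finset.card_insert_of_notMem (by simp)]
      refine le_trans ?_ (Nat.succ_le_succ ih)
      refine le_trans (Finset.card_le_card (t := insert b (highBins (load τ w t) (h + 1))) ?_)
        (Finset.card_insert_le _ _)
      intro v hv
      rcases eq_or_ne v b with rfl | hne
      · exact Finset.mem_insert_self _ _
      · apply Finset.mem_insert_of_mem
        simpa [highBins, load, ← hb, Pi.single_eq_of_ne hne] using hv
    · refine le_trans (Finset.card_le_card ?_) ih
      intro v hv
      rcases eq_or_ne v b with rfl | hne
      · simp [highBins, load, ← hb] at hv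
        omega
      · simpa [highBins, load, ← hb, Pi.single_eq_of_ne hne] using hv

theorem highBins_mono_time (τ : TieRule G) (w : ℕ → WalkState G) (h : ℕ) {s t : ℕ} (hst : s ≤ t) :
    highBins (load τ w s) h ⊆ highBins (load τ w t) h := by
  have hm : Monotone (load τ w) := monotone_nat_of_le_succ fun t => by simp [load]
  intro v hv
  simp only [highBins, Finset.mem_filter, Finset.mem_univ, true_and] at hv ⊢
  exact hv.trans (hm hst v)

theorem mul_card_highBins_le (τ : TieRule G) (w : ℕ → WalkState G) (h t : ℕ) :
    h * (highBins (load τ w t) h).card ≤ t := by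
  have hsum : ∀ t, ∑ v, load τ w t v = t := by
    intro t
    induction t with
    | zero => simp [load]
    | succ t ih => simp [load, Finset.sum_add_distrib, ih]
  calc h * (highBins (load τ w t) h).card = ∑ v ∈ highBins (load τ w t) h, h := by
        rw [Finset.sum_const, smul_eq_mul, mul_comm]
    _ ≤ ∑ v ∈ highBins (load τ w t) h, load τ w t v :=
        Finset.sum_le_sum fun v hv => (Finset.mem_filter.1 hv).2
    _ ≤ ∑ v, load τ w t v := Finset.sum_le_univ_sum_of_nonneg fun _ => Nat.zero_le _
    _ = t := hsum t

end Loads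

/-! ### Decomposition into epochs -/

section Epochs

variable {V : Type*} [Fintype V] [LinearOrder V] {G : SimpleGraph V} [DecidableRel G.Adj]
  (hG : G.IsRegularOfDegree 2)

/-- The state of the walkers `i` steps after they have been placed on `p 0` and `p 1`, if no
restart has happened since. -/
def epochState (p : Fin 2 → G.Dart) (i : ℕ) : WalkState G where
  edge j := (nextDart hG)^[i] (p j)
  visited := (Finset.range (i + 1) ×ˢ Finset.univ).image fun x => headAt hG (p x.2) x.1
  age := i

theorem mem_visited_epochState {p : Fin 2 → G.Dart} {i : ℕ} {v : V} :
    v ∈ (epochState hG p i).visited ↔ ∃ k ≤ i, ∃ j, headAt hG (p j) k = v := by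
  simp only [epochState, Finset.mem_image, Finset.mem_product, Finset.mem_range, Finset.mem_univ,
    and_true, Prod.exists, Nat.lt_succ_iff]
  grind

theorem epochState_zero (p : Fin 2 → G.Dart) : epochState hG p 0 = freshState p := by
  refine WalkState.ext rfl ?_ rfl
  ext v
  rw [mem_visited_epochState]
  simp [freshState, headAt, Fin.exists_fin_two, eq_comm]

theorem stepState_epochState (p : Fin 2 → G.Dart) (i : ℕ) (d : Fin 2 → Fin (2 - 1)) :
    stepState hG (epochState hG p i) d = epochState hG p (i + 1) := by
  have h : ∀ j, advance hG ((epochState hG p i).edge j) (d j) = (nextDart hG)^[i + 1] (p j) := by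
    intro j
    rw [advance_eq_nextDart, Function.iterate_succ_apply']
    rfl
  refine WalkState.ext (funext h) ?_ rfl
  ext v
  rw [mem_visited_epochState]
  simp only [stepState, h, Finset.mem_union, mem_visited_epochState, Finset.mem_insert,
    Finset.mem_singleton, Fin.exists_fin_two]
  constructor
  · rintro (⟨k, hk, hv⟩ | rfl | rfl)
    · exact ⟨k, by omega, hv⟩
    · exact ⟨i + 1, le_rfl, Or.inl rfl⟩
    · exact ⟨i + 1, le_rfl, Or.inr rfl⟩
  · rintro ⟨k, hk, hv⟩
    rcases Nat.lt_or_eq_of_le hk with hk | rfl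
    · exact Or.inl ⟨k, by omega, hv⟩
    · exact Or.inr (hv.imp Eq.symm Eq.symm)

theorem mustRestart_epochState {L : ℕ} {p : Fin 2 → G.Dart} {i : ℕ} {d : Fin 2 → Fin (2 - 1)} :
    MustRestart hG L (epochState hG p i) d ↔
      (∃ j, headAt hG (p j) (i + 1) ∈ (epochState hG p i).visited) ∨ i + 1 = L := by
  have h : ∀ j, advance hG ((epochState hG p i).edge j) (d j) = (nextDart hG)^[i + 1] (p j) := by
    intro j
    rw [advance_eq_nextDart, Function.iterate_succ_apply']
    rfl
  simp only [MustRestart, h]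
  rfl

/-- A restart takes place at time `t`; the initial placement counts as a restart. -/
def IsRestart (L : ℕ) (ω : ℕ → Input G 2) : ℕ → Prop
  | 0 => True
  | t + 1 => MustRestart hG L (walk hG L ω t) (ω (t + 1)).2

variable {L : ℕ} {ω ω' : ℕ → Input G 2}

theorem walk_of_isRestart {t : ℕ} (h : IsRestart hG L ω t) :
    walk hG L ω t = epochState hG (ω t).1 0 := by
  rw [epochState_zero]
  cases t with
  | zero => rfl
  | succ t => exact if_pos h

theorem walk_of_not_isRestart {t : ℕ} (h : ¬ IsRestart hG L ω (t + 1)) :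
    walk hG L ω (t + 1) = stepState hG (walk hG L ω t) (ω (t + 1)).2 :=
  if_neg h

theorem walk_congr {t : ℕ} (h : ∀ s ≤ t, ω s = ω' s) : walk hG L ω t = walk hG L ω' t := by
  induction t with
  | zero => simp only [walk, h 0 le_rfl]
  | succ t ih =>
    simp only [walk]
    rw [h (t + 1) le_rfl, ih fun s hs => h s (hs.trans t.le_succ)]

/-- The inequality is strict: with a single possible rank, the proposals at time `t` are determined
by the past. So the edges drawn at a restart are independent of the event that it occurs. -/
theorem isRestart_congr {t : ℕ} (h : ∀ s < t, ω s = ω' s) :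
    IsRestart hG L ω t ↔ IsRestart hG L ω' t := by
  cases t with
  | zero => rfl
  | succ t =>
    simp only [IsRestart, MustRestart, advance_eq_nextDart,
      walk_congr hG (L := L) fun s hs => h s (Nat.lt_succ_of_le hs)]

theorem pos_epochState (p : Fin 2 → G.Dart) (i : ℕ) (j : Fin 2) :
    (epochState hG p i).pos j = headAt hG (p j) i := rfl

/-- Each time belongs to an epoch, and in the course of an epoch the walkers see the loads that
the bins had at its start. -/
theorem exists_epoch (hL : 0 < L) (τ : TieRule G) (t : ℕ) :
    ∃ r i, t = r + i ∧ i < L ∧ IsRestart hG L ω r ∧ walk hG L ω t = epochState hG (ω r).1 i ∧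
      (∀ v ∉ (walk hG L ω t).visited,
        load τ (walk hG L ω) (t + 1) v = load τ (walk hG L ω) r v) ∧
      ∀ j, load τ (walk hG L ω) t ((walk hG L ω t).pos j) =
        load τ (walk hG L ω) r ((walk hG L ω t).pos j) := by
  have fresh : ∀ t, IsRestart hG L ω t → ∃ r i, t = r + i ∧ i < L ∧ IsRestart hG L ω r ∧
      walk hG L ω t = epochState hG (ω r).1 i ∧
      (∀ v ∉ (walk hG L ω t).visited,
        load τ (walk hG L ω) (t + 1) v = load τ (walk hG L ω) r v) ∧
      ∀ j, load τ (walk hG L ω) t ((walk hG L ω t).pos j) =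
        load τ (walk hG L ω) r ((walk hG L ω t).pos j) := by
    intro t h
    have hw := walk_of_isRestart hG h
    refine ⟨t, 0, rfl, hL, h, hw, fun v hv => load_succ_of_ne fun j hj => hv ?_, fun j => rfl⟩
    rw [hw, mem_visited_epochState]
    rw [hw, pos_epochState] at hj
    exact ⟨0, le_rfl, j, hj⟩
  induction t with
  | zero => exact fresh 0 trivial
  | succ t ih =>
    by_cases h : IsRestart hG L ω (t + 1)
    · exact fresh _ h
    -- The clause on unvisited vertices carries the induction; the clause on positions follows from
    -- it, as the walkers step onto unvisited vertices.
    obtain ⟨r, i, rfl, hi, hr, hw, hv, -⟩ := ih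
    have hw' : walk hG L ω (r + i + 1) = epochState hG (ω r).1 (i + 1) := by
      rw [walk_of_not_isRestart hG h, hw, stepState_epochState]
    have hn : ¬ MustRestart hG L (walk hG L ω (r + i)) (ω (r + i + 1)).2 := h
    rw [hw, mustRestart_epochState] at hn
    push Not at hn
    refine ⟨r, i + 1, rfl, by omega, hr, hw', fun v hv' => ?_, fun j => ?_⟩
    · rw [hw', mem_visited_epochState] at hv'
      push Not at hv'
      rw [load_succ_of_ne, hv]
      · rw [hw, mem_visited_epochState]
        rintro ⟨k, hk, j, hj⟩
        exact hv' k (by omega) j hj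
      · intro j
        rw [hw', pos_epochState]
        exact hv' _ le_rfl j
    · apply hv
      rw [hw', pos_epochState, hw]
      exact hn.1 j

/-- The number of steps of a full epoch at which both walkers are in `S`. -/
def hits (L : ℕ) (S : Finset V) (p : Fin 2 → G.Dart) : ℕ :=
  ((Finset.range L).filter fun i => ∀ j, headAt hG (p j) i ∈ S).card

theorem hits_le (S : Finset V) (p : Fin 2 → G.Dart) : hits hG L S p ≤ L :=
  (Finset.card_filter_le _ _).trans_eq (Finset.card_range L)

open Classical in
/-- The bins that reach a load above `h` are at most as many as the steps at which both walkers
would see a load of at least `h` if all epochs were full. -/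
theorem card_highBins_succ_le_sum_hits (hL : 0 < L) (τ : TieRule G) (h t : ℕ) :
    (highBins (load τ (walk hG L ω) t) (h + 1)).card ≤
      ∑ r ∈ (Finset.range t).filter (IsRestart hG L ω),
        hits hG L (highBins (load τ (walk hG L ω) r) h) (ω r).1 := by
  refine (card_highBins_succ_le τ _ h t).trans ?_
  simp only [hits]
  rw [← Finset.card_sigma]
  -- A time is encoded by the start of its epoch and its age in it.
  refine Finset.card_le_card_of_injOn
    (fun s => ⟨s - (walk hG L ω s).age, (walk hG L ω s).age⟩) ?_ ?_
  · intro s hs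
    obtain ⟨r, i, rfl, hi, hr, hw, -, hload⟩ := exists_epoch hG (ω := ω) hL τ s
    have ha : (walk hG L ω (r + i)).age = i := by rw [hw]; rfl
    simp only [Finset.coe_filter, Finset.mem_range, Set.mem_ofPred_eq] at hs
    simp only [Finset.coe_sigma, Set.mem_sigma_iff, ha, Nat.add_sub_cancel, Finset.coe_filter,
      Finset.mem_range, Set.mem_ofPred_eq]
    refine ⟨⟨by omega, hr⟩, hi, fun j => ?_⟩
    simp only [highBins, Finset.mem_filter, Finset.mem_univ, true_and]
    rw [← pos_epochState, ← hw, ← hload j]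
    exact hs.2.trans (apply_chosenBin_le _ _ _ _ _)
  · intro s _ s' _ hss
    obtain ⟨r, i, rfl, hi, hr, hw, -, -⟩ := exists_epoch hG (ω := ω) hL τ s
    obtain ⟨r', i', rfl, hi', hr', hw', -, -⟩ := exists_epoch hG (ω := ω) hL τ s'
    have ha : (walk hG L ω (r + i)).age = i := by rw [hw]; rfl
    have ha' : (walk hG L ω (r' + i')).age = i' := by rw [hw']; rfl
    simp only [ha, ha', Nat.add_sub_cancel, Sigma.mk.injEq] at hss
    obtain ⟨rfl, h2⟩ := hss
    rw [eq_of_heq h2]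

/-- The two full trajectories starting from `p` intersect. -/
def Collide (L : ℕ) (p : Fin 2 → G.Dart) : Prop :=
  ∃ i < L, ∃ k < L, headAt hG (p 0) i = headAt hG (p 1) k

/-- A restart before age `L` would need a trajectory to meet itself, against `hinj`, or the other
one. -/
theorem not_isRestart_of_not_collide
    (hinj : ∀ (e : G.Dart) (i k : ℕ), i < k → k < L → headAt hG e i ≠ headAt hG e k)
    {r : ℕ} (hr : IsRestart hG L ω r) (hc : ¬ Collide hG L (ω r).1) (i : ℕ) (hi : i + 1 < L) :
    ¬ IsRestart hG L ω (r + i + 1) := by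
  have step : ∀ i, i + 1 < L → walk hG L ω (r + i) = epochState hG (ω r).1 i →
      ¬ IsRestart hG L ω (r + i + 1) := by
    intro i hi hw
    change ¬ MustRestart hG L (walk hG L ω (r + i)) (ω (r + i + 1)).2
    rw [hw, mustRestart_epochState]
    rintro (⟨j, hj⟩ | h)
    · rw [mem_visited_epochState] at hj
      obtain ⟨k, hk, j', hj'⟩ := hj
      by_cases hjj : j' = j
      · subst hjj
        exact hinj _ k (i + 1) (by omega) hi hj'
      · apply hc
        have : (j = 0 ∧ j' = 1) ∨ (j = 1 ∧ j' = 0) := by omega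
        rcases this with ⟨rfl, rfl⟩ | ⟨rfl, rfl⟩
        · exact ⟨i + 1, hi, k, by omega, hj'.symm⟩
        · exact ⟨k, by omega, i + 1, hi, hj'⟩
    · omega
  have hw : ∀ i, i < L → walk hG L ω (r + i) = epochState hG (ω r).1 i := by
    intro i
    induction i with
    | zero => exact fun _ => walk_of_isRestart hG hr
    | succ i ih =>
      intro hi
      have := ih (by omega)
      rw [← add_assoc, walk_of_not_isRestart hG (step i hi this), this, stepState_epochState]
  exact step i hi (hw i (by omega))

open Classical in
/-- All epochs but those in which the trajectories intersect last for `L` steps. -/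
theorem card_isRestart_le
    (hL : 0 < L) (hinj : ∀ (e : G.Dart) (i k : ℕ), i < k → k < L → headAt hG e i ≠ headAt hG e k)
    (t : ℕ) :
    ((Finset.range t).filter (IsRestart hG L ω)).card ≤
      ((Finset.range t).filter fun r => IsRestart hG L ω r ∧ Collide hG L (ω r).1).card
        + (t / L + 1) := by
  rw [← Finset.card_filter_add_card_filter_not (s := (Finset.range t).filter (IsRestart hG L ω))
    (fun r => Collide hG L (ω r).1), Finset.filter_filter, Finset.filter_filter]
  refine Nat.add_le_add_left ?_ _
  rw [← Finset.card_range (t / L + 1)]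
  -- No restart occurs within fewer than `L` steps after a collision-free one, so each block of `L`
  -- consecutive times starting at a multiple of `L` contains at most one collision-free restart.
  have far : ∀ r s, IsRestart hG L ω r ∧ ¬ Collide hG L (ω r).1 → IsRestart hG L ω s → r < s →
      r / L < s / L := by
    intro r s hr hs hrs
    have : r + L ≤ s := by
      by_contra! hlt
      obtain ⟨i, rfl⟩ := Nat.exists_eq_add_of_lt hrs
      exact not_isRestart_of_not_collide hG hinj hr.1 hr.2 i (by omega) hs
    calc r / L < r / L + 1 := Nat.lt_succ_self _
      _ = (r + L) / L := (Nat.add_div_right r hL).symm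
      _ ≤ s / L := Nat.div_le_div_right this
  refine Finset.card_le_card_of_injOn (fun r => r / L) ?_ ?_
  · intro r hr
    simp only [Finset.coe_filter, Finset.mem_range, Set.mem_ofPred_eq] at hr
    simp only [Finset.coe_range, Set.mem_Iio]
    exact Nat.lt_succ_of_le (Nat.div_le_div_right hr.1.le)
  · intro r hr s hs hrs
    simp only [Finset.coe_filter, Finset.mem_range, Set.mem_ofPred_eq] at hr hs
    rcases lt_trichotomy r s with h | h | h
    · exact absurd hrs (far r s hr.2 hs.2.1 h).ne
    · exact h
    · exact absurd hrs (far s r hs.2 hr.2.1 h).ne'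

end Epochs

/-! ### Exponential supermartingales for independent uniform samples -/

section Resampling

variable {α : Type*}

theorem dependsOn_comp_update {β : Type*} {X : (ℕ → α) → β} {t : ℕ}
    (hX : DependsOn X (Set.Iio t)) (ω : ℕ → α) (a : α) : X (Function.update ω t a) = X ω :=
  hX fun _ hs => Function.update_of_ne (Set.mem_Iio.1 hs).ne _ _

theorem uniformOn_univ_real_singleton [Fintype α] [MeasurableSpace α] [DiscreteMeasurableSpace α] (a : α) :
    (uniformOn (Set.univ : Set α)).real {a} = (Fintype.card α : ℝ)⁻¹ := by
  rw [Measure.real, uniformOn_univ]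
  simp

variable [Fintype α] [Nonempty α] [MeasurableSpace α] [DiscreteMeasurableSpace α]

/-- The law of independent uniform samples of a finite type. -/
noncomputable abbrev iidUniform (α : Type*) [MeasurableSpace α] : Measure (ℕ → α) :=
  Measure.infinitePi fun _ => uniformOn Set.univ

instance : IsProbabilityMeasure (uniformOn (Set.univ : Set α)) :=
  isProbabilityMeasure_uniformOn Set.finite_univ Set.univ_nonempty

/-- `X` factors through the finite discrete space of the first `t` coordinates; the value `a` merely
fills the others. -/
theorem measurable_of_dependsOn_Iio {β : Type*} [MeasurableSpace β] {X : (ℕ → α) → β} {t : ℕ}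
    (hX : DependsOn X (Set.Iio t)) : Measurable X := by
  obtain ⟨a⟩ := ‹Nonempty α›
  have : X = (fun y : Fin t → α => X fun s => if h : s < t then y ⟨s, h⟩ else a) ∘
      fun ω s => ω s := by
    funext ω
    refine hX fun s hs => ?_
    simp [Set.mem_Iio.1 hs]
  rw [this]
  exact (Measurable.of_discrete).comp (measurable_pi_lambda _ fun s => measurable_pi_apply _)

theorem integrable_of_dependsOn_Iio {X : (ℕ → α) → ℝ} {t : ℕ}
    (hX : DependsOn X (Set.Iio t)) : Integrable X (iidUniform α) := by
  obtain ⟨a⟩ := ‹Nonempty α›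
  set g : (Fin t → α) → ℝ := fun y => X fun s => if h : s < t then y ⟨s, h⟩ else a with hg
  have hXg : ∀ ω, X ω = g fun s => ω s := by
    intro ω
    refine hX fun s hs => ?_
    simp [Set.mem_Iio.1 hs]
  refine Integrable.of_bound (measurable_of_dependsOn_Iio hX).aestronglyMeasurable
    (∑ y, ‖g y‖) (Filter.Eventually.of_forall fun ω => ?_)
  rw [hXg]
  exact Finset.single_le_sum (f := fun y => ‖g y‖) (fun _ _ => norm_nonneg _)
    (Finset.mem_univ fun s : Fin t => ω s)

theorem map_update_iidUniform (t : ℕ) :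
    ((iidUniform α).prod (uniformOn (Set.univ : Set α))).map
      (fun p : (ℕ → α) × α => Function.update p.1 t p.2) = iidUniform α := by
  have hm : Measurable fun p : (ℕ → α) × α => Function.update p.1 t p.2 := measurable_update'
  refine Measure.eq_infinitePi _ fun s B hB => ?_
  rw [Measure.map_apply hm (MeasurableSet.pi s.countable_toSet fun i _ => hB i)]
  by_cases ht : t ∈ s
  · have : (fun p : (ℕ → α) × α => Function.update p.1 t p.2) ⁻¹' (s : Set ℕ).pi B =
        ((s.erase t : Finset ℕ) : Set ℕ).pi B ×ˢ B t := by
      ext ⟨ω, a⟩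
      simp only [Set.mem_preimage, Set.mem_pi, Finset.mem_coe, Set.mem_prod, Finset.mem_erase]
      constructor
      · intro h
        refine ⟨fun i hi => ?_, by simpa using h t ht⟩
        simpa [Function.update_of_ne hi.1] using h i hi.2
      · rintro ⟨h1, h2⟩ i hi
        rcases eq_or_ne i t with rfl | hne
        · simpa using h2
        · simpa [Function.update_of_ne hne] using h1 i ⟨hne, hi⟩
    rw [this, Measure.prod_prod, Measure.infinitePi_pi _ fun i _ => hB i, Finset.prod_erase_mul _ _ ht]
  · have : (fun p : (ℕ → α) × α => Function.update p.1 t p.2) ⁻¹' (s : Set ℕ).pi B =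
        (s : Set ℕ).pi B ×ˢ Set.univ := by
      ext ⟨ω, a⟩
      simp only [Set.mem_preimage, Set.mem_pi, Finset.mem_coe, Set.mem_prod, Set.mem_univ, and_true]
      refine forall₂_congr fun i hi => ?_
      rw [Function.update_of_ne (ne_of_mem_of_not_mem hi ht)]
    rw [this, Measure.prod_prod, Measure.infinitePi_pi _ fun i _ => hB i, measure_univ, mul_one]

/-- Resampling one coordinate does not change an expectation. -/
theorem integral_resample {X : (ℕ → α) → ℝ} {T : ℕ} (hX : DependsOn X (Set.Iio T)) (t : ℕ) :
    ∫ ω, X ω ∂iidUniform α =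
      ∫ ω, (Fintype.card α : ℝ)⁻¹ * ∑ a, X (Function.update ω t a) ∂iidUniform α := by
  have hm : Measurable fun p : (ℕ → α) × α => Function.update p.1 t p.2 := measurable_update'
  have hXm := measurable_of_dependsOn_Iio hX
  have hXi := integrable_of_dependsOn_Iio hX
  conv_lhs => rw [← map_update_iidUniform t]
  rw [← map_update_iidUniform t] at hXi
  rw [integral_map hm.aemeasurable hXm.aestronglyMeasurable,
    integral_prod (fun p : (ℕ → α) × α => X (Function.update p.1 t p.2))
      ((integrable_map_measure hXm.aestronglyMeasurable hm.aemeasurable).1 hXi)]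
  refine integral_congr_ae (Filter.Eventually.of_forall fun ω => ?_)
  simp only
  rw [integral_fintype (Integrable.of_finite), Finset.mul_sum]
  refine Finset.sum_congr rfl fun a _ => ?_
  rw [uniformOn_univ_real_singleton, smul_eq_mul]

/-- The exponential is a supermartingale. Conditional expectation given the past is replaced by the
average over a resampled coordinate. -/
theorem integral_exp_sum_le_one {W ρ : ℕ → (ℕ → α) → ℝ}
    (hW : ∀ t, DependsOn (W t) (Set.Iio (t + 1))) (hρ : ∀ t, DependsOn (ρ t) (Set.Iio t))
    (h : ∀ t ω, (Fintype.card α : ℝ)⁻¹ * ∑ a, Real.exp (W t (Function.update ω t a)) ≤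
      Real.exp (ρ t ω)) (T : ℕ) :
    ∫ ω, Real.exp (∑ t ∈ Finset.range T, (W t ω - ρ t ω)) ∂iidUniform α ≤ 1 := by
  have hdep : ∀ T, DependsOn (fun ω => Real.exp (∑ t ∈ Finset.range T, (W t ω - ρ t ω)))
      (Set.Iio T) := by
    intro T x y hxy
    simp only
    congr 1
    refine Finset.sum_congr rfl fun t ht => ?_
    have ht := Finset.mem_range.1 ht
    rw [hW t fun s hs => hxy s (by simp at hs ⊢; omega),
      hρ t fun s hs => hxy s (by simp at hs ⊢; omega)]
  induction T with
  | zero => simp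
  | succ T ih =>
    -- Resampling coordinate `T` affects only the last factor, whose average is at most `1` by `h`.
    rw [integral_resample (hdep (T + 1)) T]
    refine le_trans (integral_mono_of_nonneg (Filter.Eventually.of_forall fun ω => ?_)
      (integrable_of_dependsOn_Iio (hdep T)) (Filter.Eventually.of_forall fun ω => ?_)) ih
    · simp only [Pi.zero_apply]
      positivity
    · simp only [Finset.sum_range_succ, Real.exp_add, Real.exp_sub (W T _),
        dependsOn_comp_update (hρ T)]
      have : ∀ a, Real.exp (∑ t ∈ Finset.range T,
          (W t (Function.update ω T a) - ρ t (Function.update ω T a))) =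
          Real.exp (∑ t ∈ Finset.range T, (W t ω - ρ t ω)) := fun a =>
        dependsOn_comp_update (hdep T) ω a
      simp only [this]
      rw [← Finset.mul_sum, ← Finset.sum_div]
      have h1 := h T ω
      have h2 := Real.exp_pos (ρ T ω)
      calc _ = Real.exp (∑ t ∈ Finset.range T, (W t ω - ρ t ω)) *
            (((Fintype.card α : ℝ)⁻¹ * ∑ a, Real.exp (W T (Function.update ω T a))) /
              Real.exp (ρ T ω)) := by ring
        _ ≤ Real.exp (∑ t ∈ Finset.range T, (W t ω - ρ t ω)) * 1 := by
            gcongr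
            exact (div_le_one h2).2 h1
        _ = _ := mul_one _

/-- A Chernoff bound for adapted sequences. -/
theorem measureReal_le_exp_neg {W ρ : ℕ → (ℕ → α) → ℝ}
    (hW : ∀ t, DependsOn (W t) (Set.Iio (t + 1))) (hρ : ∀ t, DependsOn (ρ t) (Set.Iio t))
    (h : ∀ t ω, (Fintype.card α : ℝ)⁻¹ * ∑ a, Real.exp (W t (Function.update ω t a)) ≤
      Real.exp (ρ t ω)) (T : ℕ) (x : ℝ) :
    (iidUniform α).real {ω | x ≤ ∑ t ∈ Finset.range T, (W t ω - ρ t ω)} ≤ Real.exp (-x) := by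
  have hdep : DependsOn (fun ω => Real.exp (∑ t ∈ Finset.range T, (W t ω - ρ t ω)))
      (Set.Iio T) := by
    intro x y hxy
    simp only
    congr 1
    refine Finset.sum_congr rfl fun t ht => ?_
    have ht := Finset.mem_range.1 ht
    rw [hW t fun s hs => hxy s (by simp at hs ⊢; omega),
      hρ t fun s hs => hxy s (by simp at hs ⊢; omega)]
  have := mul_meas_ge_le_integral_of_nonneg (μ := iidUniform α)
    (f := fun ω => Real.exp (∑ t ∈ Finset.range T, (W t ω - ρ t ω)))
    (Filter.Eventually.of_forall fun ω => (Real.exp_pos _).le)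
    (integrable_of_dependsOn_Iio hdep) (Real.exp x)
  have h1 := this.trans (integral_exp_sum_le_one hW hρ h T)
  simp only [Real.exp_le_exp] at h1
  rw [Real.exp_neg, ← one_div, le_div_iff₀ (Real.exp_pos x), mul_comm]
  exact h1

end Resampling

/-! ### Averages over the edges drawn at a restart -/

section Inputs

variable {V : Type*} [Fintype V] [LinearOrder V] {G : SimpleGraph V} [DecidableRel G.Adj]
  (hG : G.IsRegularOfDegree 2)

/-- The average over one input is the average over two directed edges. -/
theorem average_input (hG : G.IsRegularOfDegree 2) (f : (Fin 2 → G.Dart) → ℝ) :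
    (Fintype.card (Input G 2) : ℝ)⁻¹ * ∑ a : Input G 2, f a.1 =
      ((2 * Fintype.card V : ℝ) ^ 2)⁻¹ * ∑ e : G.Dart, ∑ e' : G.Dart, f ![e, e'] := by
  have h1 : Fintype.card (Input G 2) = (2 * Fintype.card V) ^ 2 := by
    simp [Input, card_dart hG]
  rw [h1, Fintype.sum_prod_type, ← (finTwoArrowEquiv G.Dart).symm.sum_comp, Fintype.sum_prod_type]
  simp [finTwoArrowEquiv]

/-- At each step the two positions are independent and uniform; the probabilities are summed over
the steps. -/
theorem average_hits_le (L : ℕ) (S : Finset V) :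
    (Fintype.card (Input G 2) : ℝ)⁻¹ * ∑ a : Input G 2, (hits hG L S a.1 : ℝ) ≤
      L * ((S.card : ℝ) / Fintype.card V) ^ 2 := by
  have hs : ∑ e : G.Dart, ∑ e' : G.Dart, (hits hG L S ![e, e'] : ℝ) = L * (2 * S.card) ^ 2 := by
    have h1 : ∀ e e' : G.Dart, (hits hG L S ![e, e'] : ℝ) = ∑ i ∈ Finset.range L,
        (if headAt hG e i ∈ S then (1 : ℝ) else 0) * (if headAt hG e' i ∈ S then 1 else 0) := by
      intro e e'
      rw [hits, Finset.card_filter]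
      push_cast
      refine Finset.sum_congr rfl fun i _ => ?_
      rw [ite_zero_mul_ite_zero, one_mul]
      simp [Fin.forall_fin_two]
    have h2 : ∀ i, ∑ e : G.Dart, (if headAt hG e i ∈ S then (1 : ℝ) else 0) = 2 * S.card := by
      intro i
      rw [Finset.sum_boole, card_headAt_mem]
      push_cast
      rfl
    simp only [h1]
    have h3 : ∀ e : G.Dart, ∑ e' : G.Dart, ∑ i ∈ Finset.range L,
        (if headAt hG e i ∈ S then (1 : ℝ) else 0) * (if headAt hG e' i ∈ S then 1 else 0) =
        ∑ i ∈ Finset.range L, (if headAt hG e i ∈ S then (1 : ℝ) else 0) * (2 * S.card) := by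
      intro e
      rw [Finset.sum_comm]
      refine Finset.sum_congr rfl fun i _ => ?_
      rw [← Finset.mul_sum, h2]
    simp only [h3]
    rw [Finset.sum_comm]
    simp only [← Finset.sum_mul, h2]
    rw [Finset.sum_const, Finset.card_range, nsmul_eq_mul]
    ring
  rw [average_input hG fun p => (hits hG L S p : ℝ), hs]
  apply le_of_eq
  rcases eq_or_ne (Fintype.card V : ℝ) 0 with h | h
  · simp [h]
  · field_simp

-- Union bound over the `L ^ 2` pairs of steps, each pair of positions agreeing with probability `1
-- / Fintype.card V`.
open Classical in
theorem average_collide_le (L : ℕ) :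
    (Fintype.card (Input G 2) : ℝ)⁻¹ *
      ∑ a : Input G 2, (if Collide hG L a.1 then (1 : ℝ) else 0) ≤
        (L : ℝ) ^ 2 / Fintype.card V := by
  have hs : ∑ e : G.Dart, ∑ e' : G.Dart, (if Collide hG L ![e, e'] then (1 : ℝ) else 0) ≤
      L ^ 2 * (4 * Fintype.card V) := by
    have h1 : ∀ e e' : G.Dart, (if Collide hG L ![e, e'] then (1 : ℝ) else 0) ≤
        ∑ i ∈ Finset.range L, ∑ k ∈ Finset.range L,
          (if headAt hG e' k ∈ ({headAt hG e i} : Finset V) then (1 : ℝ) else 0) := by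
      intro e e'
      split_ifs with hc
      · obtain ⟨i, hi, k, hk, hik⟩ := hc
        have hik : headAt hG e i = headAt hG e' k := hik
        calc (1 : ℝ) = if headAt hG e' k ∈ ({headAt hG e i} : Finset V) then (1 : ℝ) else 0 := by
              simp [hik]
          _ ≤ ∑ k ∈ Finset.range L,
              (if headAt hG e' k ∈ ({headAt hG e i} : Finset V) then (1 : ℝ) else 0) :=
            Finset.single_le_sum (f := fun k =>
              if headAt hG e' k ∈ ({headAt hG e i} : Finset V) then (1 : ℝ) else 0)
              (fun _ _ => by positivity) (Finset.mem_range.2 hk)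
          _ ≤ _ := Finset.single_le_sum (f := fun i => ∑ k ∈ Finset.range L,
              (if headAt hG e' k ∈ ({headAt hG e i} : Finset V) then (1 : ℝ) else 0))
              (fun _ _ => by positivity) (Finset.mem_range.2 hi)
      · positivity
    refine (Finset.sum_le_sum fun e _ => Finset.sum_le_sum fun e' _ => h1 e e').trans ?_
    have h2 : ∀ e : G.Dart, ∑ e' : G.Dart, ∑ i ∈ Finset.range L, ∑ k ∈ Finset.range L,
        (if headAt hG e' k ∈ ({headAt hG e i} : Finset V) then (1 : ℝ) else 0) = L ^ 2 * 2 := by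
      intro e
      rw [Finset.sum_comm]
      have : ∀ i ∈ Finset.range L, ∑ e' : G.Dart, ∑ k ∈ Finset.range L,
          (if headAt hG e' k ∈ ({headAt hG e i} : Finset V) then (1 : ℝ) else 0) = L * 2 := by
        intro i _
        rw [Finset.sum_comm]
        have : ∀ k ∈ Finset.range L, ∑ e' : G.Dart,
            (if headAt hG e' k ∈ ({headAt hG e i} : Finset V) then (1 : ℝ) else 0) = 2 := by
          intro k _
          rw [Finset.sum_boole, card_headAt_mem]
          simp
        rw [Finset.sum_congr rfl this, Finset.sum_const, Finset.card_range, nsmul_eq_mul]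
      rw [Finset.sum_congr rfl this, Finset.sum_const, Finset.card_range, nsmul_eq_mul]
      ring
    rw [Finset.sum_congr rfl fun e _ => h2 e, Finset.sum_const, Finset.card_univ, card_dart hG,
      nsmul_eq_mul]
    push_cast
    apply le_of_eq
    ring
  rw [average_input hG fun p => if Collide hG L p then (1 : ℝ) else 0]
  refine (mul_le_mul_of_nonneg_left hs (by positivity)).trans (le_of_eq ?_)
  rcases eq_or_ne (Fintype.card V : ℝ) 0 with h | h
  · simp [h]
  · field_simp
    ring

end Inputs

theorem card_pos_real {V : Type*} [Fintype V] [Nonempty V] : (0 : ℝ) < Fintype.card V := Nat.cast_pos.2 Fintype.card_pos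

theorem load_walk_congr {V : Type*} [Fintype V] [LinearOrder V] {G : SimpleGraph V}
    [DecidableRel G.Adj] (hG : G.IsRegularOfDegree 2) {L : ℕ} (τ : TieRule G) {ω ω' : ℕ → Input G 2} {t : ℕ} (h : ∀ s < t, ω s = ω' s) :
    load τ (walk hG L ω) t = load τ (walk hG L ω') t :=
  load_congr fun _ hs => walk_congr hG fun u hu => h u (hu.trans_lt hs)

/-! ### Chernoff bounds over epochs and the layered induction -/

section MaxLoad

variable {V : Type*} [Fintype V] [LinearOrder V] [Nonempty V] {G : SimpleGraph V}
  [DecidableRel G.Adj] (hG : G.IsRegularOfDegree 2) {L : ℕ}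

/-- By convexity the exponential lies below its chord. -/
theorem exp_mul_le {x : ℝ} (hx0 : 0 ≤ x) (hx1 : x ≤ 1) (l : ℝ) :
    Real.exp (l * x) ≤ 1 + (Real.exp l - 1) * x := by
  have := convexOn_exp.2 (Set.mem_univ l) (Set.mem_univ 0) hx0 (sub_nonneg.2 hx1) (by ring)
  simp only [smul_eq_mul, mul_zero, add_zero, Real.exp_zero] at this
  rw [mul_comm l x]
  linarith

theorem nonempty_input (hG : G.IsRegularOfDegree 2) : Nonempty (Input G 2) := by
  have : Nonempty G.Dart := by
    rw [← Fintype.card_pos_iff, card_dart hG]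
    have := Fintype.card_pos (α := V)
    omega
  exact inferInstance

theorem isProbabilityMeasure_inputLaw (hG : G.IsRegularOfDegree 2) :
    IsProbabilityMeasure (inputLaw G 2) := by
  have := nonempty_input hG
  unfold inputLaw
  infer_instance

variable (L) in
open Classical in
/-- The times before `t` at which a restart takes place. -/
noncomputable def restarts (ω : ℕ → Input G 2) (t : ℕ) : Finset ℕ :=
  (Finset.range t).filter (IsRestart hG L ω)

/-- A Chernoff bound for a sum over the restarts. -/
theorem measureReal_sum_restarts_le {g : ℕ → (ℕ → Input G 2) → (Fin 2 → G.Dart) → ℝ}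
    (hg0 : ∀ t ω p, 0 ≤ g t ω p) (hg1 : ∀ t ω p, g t ω p ≤ 1)
    (hdep : ∀ t p, DependsOn (fun ω => g t ω p) (Set.Iio t)) {q : ℝ}
    (havg : ∀ t ω,
      (Fintype.card (Input G 2) : ℝ)⁻¹ * ∑ a : Input G 2, g t ω a.1 ≤ q)
    {l : ℝ} (hl : 0 ≤ l) (T : ℕ) (x : ℝ) :
    (inputLaw G 2).real {ω | x ≤ l * ∑ r ∈ restarts hG L ω T, g r ω (ω r).1 -
      (Real.exp l - 1) * q * (restarts hG L ω T).card} ≤ Real.exp (-x) := by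
  classical
  have := nonempty_input hG
  have := isProbabilityMeasure_inputLaw hG
  have hl' : 0 ≤ Real.exp l - 1 := sub_nonneg.2 (Real.one_le_exp hl)
  have hupd : ∀ t ω (a : Input G 2),
      (IsRestart hG L (Function.update ω t a) t ↔ IsRestart hG L ω t) := fun t ω a =>
    isRestart_congr hG fun s hs => Function.update_of_ne hs.ne _ _
  -- Times without a restart contribute `0` to both sequences.
  have key := measureReal_le_exp_neg (α := Input G 2)
    (W := fun t ω => if IsRestart hG L ω t then l * g t ω (ω t).1 else 0)
    (ρ := fun t ω => if IsRestart hG L ω t then (Real.exp l - 1) * q else 0)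
    ?_ ?_ ?_ T x
  · refine le_trans (measureReal_mono ?_) key
    intro ω hω
    simp only [Set.mem_ofPred_eq] at hω ⊢
    rw [Finset.sum_sub_distrib, ← Finset.sum_filter, ← Finset.sum_filter, Finset.sum_const,
      nsmul_eq_mul, ← Finset.mul_sum]
    rw [mul_comm _ ((restarts hG L ω T).card : ℝ)] at hω
    exact hω
  · intro t ω ω' h
    have h1 : IsRestart hG L ω t ↔ IsRestart hG L ω' t :=
      isRestart_congr hG fun s hs => h s (by simp; omega)
    have h2 : ω t = ω' t := h t (by simp)
    have h3 := hdep t (ω' t).1 (x := ω) (y := ω') fun s hs => h s (by simp at hs ⊢; omega)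
    simp only [h1, h2, h3]
  · intro t ω ω' h
    have h1 : IsRestart hG L ω t ↔ IsRestart hG L ω' t :=
      isRestart_congr hG fun s hs => h s hs
    simp only [h1]
  · intro t ω
    have hg : ∀ a : Input G 2, g t (Function.update ω t a) a.1 = g t ω a.1 := fun a =>
      dependsOn_comp_update (hdep t a.1) ω a
    simp only [hupd, Function.update_self, hg]
    have hc : (Fintype.card (Input G 2) : ℝ) ≠ 0 := Nat.cast_ne_zero.2 Fintype.card_ne_zero
    split_ifs with h
    · calc (Fintype.card (Input G 2) : ℝ)⁻¹ * ∑ a : Input G 2, Real.exp (l * g t ω a.1)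
          ≤ (Fintype.card (Input G 2) : ℝ)⁻¹ *
              ∑ a : Input G 2, (1 + (Real.exp l - 1) * g t ω a.1) := by
            gcongr with a
            exact exp_mul_le (hg0 _ _ _) (hg1 _ _ _) l
        _ = 1 + (Real.exp l - 1) *
              ((Fintype.card (Input G 2) : ℝ)⁻¹ * ∑ a : Input G 2, g t ω a.1) := by
            rw [Finset.sum_add_distrib, ← Finset.mul_sum, Finset.sum_const, Finset.card_univ,
              nsmul_eq_mul, mul_one, mul_add, inv_mul_cancel₀ hc]
            ring
        _ ≤ 1 + (Real.exp l - 1) * q := by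
            gcongr
            exact havg t ω
        _ ≤ _ := by
            rw [add_comm]
            exact Real.add_one_le_exp _
    · rw [Real.exp_zero, Finset.sum_const, Finset.card_univ, nsmul_eq_mul, mul_one,
        inv_mul_cancel₀ hc]

theorem exp_one_sub_one_le : Real.exp 1 - 1 ≤ 2 := by
  have := Real.exp_one_lt_d9
  linarith

/-- There are hardly more restarts than if all epochs were full. -/
theorem measureReal_card_restarts_le (hL : 0 < L)
    (hinj : ∀ (e : G.Dart) (i k : ℕ), i < k → k < L → headAt hG e i ≠ headAt hG e k)
    (hLn : (6 : ℝ) * L ^ 2 ≤ Fintype.card V) :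
    (inputLaw G 2).real {ω | 3 * ((Fintype.card V : ℝ) / L + 1) <
      (restarts hG L ω (Fintype.card V)).card} ≤ Real.exp (-((Fintype.card V : ℝ) / L)) := by
  classical
  have := isProbabilityMeasure_inputLaw hG
  have hn : (0 : ℝ) < Fintype.card V := card_pos_real
  have hq : (L : ℝ) ^ 2 / Fintype.card V ≤ 1 / 6 := by
    rw [div_le_iff₀ hn]
    linarith
  refine le_trans (measureReal_mono ?_) (measureReal_sum_restarts_le hG (L := L)
    (g := fun _ _ p => if Collide hG L p then 1 else 0) (fun _ _ p => by positivity)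
    (fun _ _ p => by split_ifs <;> norm_num) (fun _ p _ _ _ => rfl)
    (fun _ _ => average_collide_le hG L) zero_le_one (Fintype.card V) _)
  intro ω hω
  simp only [Set.mem_ofPred_eq] at hω ⊢
  have h := card_isRestart_le hG (ω := ω) hL hinj (Fintype.card V)
  rw [← Finset.filter_filter] at h
  change (restarts hG L ω _).card ≤
    ((restarts hG L ω _).filter fun r => Collide hG L (ω r).1).card + _ at h
  rw [Finset.sum_boole]
  have h' : ((restarts hG L ω (Fintype.card V)).card : ℝ) ≤
      ((restarts hG L ω (Fintype.card V)).filter fun r => Collide hG L (ω r).1).card +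
        ((Fintype.card V : ℝ) / L + 1) := by
    refine (Nat.cast_le.2 h).trans ?_
    push_cast
    have := Nat.cast_div_le (α := ℝ) (m := Fintype.card V) (n := L)
    linarith
  -- With `R` restarts, at least `R - (n / L + 1)` of them collide, while the compensator is at most
  -- `R / 3`. For `R > 3 * (n / L + 1)` the difference exceeds `n / L`.
  have h2 : (Real.exp 1 - 1) * ((L : ℝ) ^ 2 / Fintype.card V) ≤ 1 / 3 := by
    calc _ ≤ 2 * (1 / 6 : ℝ) := by
          gcongr
          exact exp_one_sub_one_le
      _ = _ := by norm_num
  have h3 := mul_le_mul_of_nonneg_right h2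
    (Nat.cast_nonneg (α := ℝ) (restarts hG L ω (Fintype.card V)).card)
  linarith

variable (τ : TieRule G)

/-- One step of the layered induction. -/
theorem measureReal_highBins_succ_le (hL : 0 < L) (hLn : 3 * L ≤ Fintype.card V) (h : ℕ)
    (γ : ℝ) :
    (inputLaw G 2).real {ω |
      ((restarts hG L ω (Fintype.card V)).card : ℝ) ≤ 3 * ((Fintype.card V : ℝ) / L + 1) ∧
      ((highBins (load τ (walk hG L ω) (Fintype.card V)) h).card : ℝ) ≤ γ * Fintype.card V ∧
      12 * γ ^ 2 * Fintype.card V <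
        (highBins (load τ (walk hG L ω) (Fintype.card V)) (h + 1)).card} ≤
      Real.exp (-(4 * γ ^ 2 * (Fintype.card V / L))) := by
  classical
  have := isProbabilityMeasure_inputLaw hG
  have hn : (0 : ℝ) < Fintype.card V := card_pos_real
  have hL' : (0 : ℝ) < L := Nat.cast_pos.2 hL
  have hLn' : 3 * (L : ℝ) ≤ Fintype.card V := by exact_mod_cast hLn
  -- The cutoff in `g` makes the average bound hold for every past. It is inactive on the event
  -- considered, because loads only grow. Division by `L` brings the hits into `[0, 1]`.
  refine le_trans (measureReal_mono ?_) (measureReal_sum_restarts_le hG (L := L)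
    (g := fun r ω p =>
      if ((highBins (load τ (walk hG L ω) r) h).card : ℝ) ≤ γ * Fintype.card V then
        (hits hG L (highBins (load τ (walk hG L ω) r) h) p : ℝ) / L else 0)
    (q := γ ^ 2) (fun _ _ p => by positivity) ?_ ?_ ?_ zero_le_one (Fintype.card V) _)
  · rintro ω ⟨hR, hh, hh'⟩
    simp only [Set.mem_ofPred_eq]
    have h1 := card_highBins_succ_le_sum_hits hG (ω := ω) hL τ h (Fintype.card V)
    change _ ≤ ∑ r ∈ restarts hG L ω _, _ at h1
    have h1' : ((highBins (load τ (walk hG L ω) (Fintype.card V)) (h + 1)).card : ℝ) ≤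
        ∑ r ∈ restarts hG L ω (Fintype.card V),
          (hits hG L (highBins (load τ (walk hG L ω) r) h) (ω r).1 : ℝ) := by
      exact_mod_cast h1
    have h2 : ∑ r ∈ restarts hG L ω (Fintype.card V),
        (if ((highBins (load τ (walk hG L ω) r) h).card : ℝ) ≤ γ * Fintype.card V then
          (hits hG L (highBins (load τ (walk hG L ω) r) h) (ω r).1 : ℝ) / L else 0) =
        (∑ r ∈ restarts hG L ω (Fintype.card V),
          (hits hG L (highBins (load τ (walk hG L ω) r) h) (ω r).1 : ℝ)) / L := by
      rw [Finset.sum_div]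
      refine Finset.sum_congr rfl fun r hr => if_pos (le_trans ?_ hh)
      rw [restarts, Finset.mem_filter, Finset.mem_range] at hr
      exact_mod_cast Finset.card_le_card (highBins_mono_time τ _ h hr.1.le)
    rw [h2]
    have h3 : 12 * γ ^ 2 * (Fintype.card V / L) ≤ (∑ r ∈ restarts hG L ω (Fintype.card V),
        (hits hG L (highBins (load τ (walk hG L ω) r) h) (ω r).1 : ℝ)) / L := by
      rw [← mul_div_assoc]
      gcongr
      linarith
    -- This gives `3 * (n / L + 1) ≤ 4 * (n / L)`, so the compensator is at most `8 * γ ^ 2 * (n /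
    -- L)` out of `12 * γ ^ 2 * (n / L)`.
    have h4 : (1 : ℝ) ≤ Fintype.card V / L / 3 := by
      rw [div_div, one_le_div (by positivity)]
      linarith
    have h5 : (Real.exp 1 - 1) * γ ^ 2 * (restarts hG L ω (Fintype.card V)).card ≤
        2 * γ ^ 2 * (4 * (Fintype.card V / L)) := by
      gcongr
      · exact exp_one_sub_one_le
      · linarith
    linarith
  · intro r ω p
    split_ifs
    · rw [div_le_one hL']
      exact_mod_cast hits_le hG _ p
    · exact zero_le_one
  · intro t p ω ω' hω
    simp only [load_walk_congr hG τ fun s hs => hω s hs]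
  · intro t ω
    split_ifs with hc
    · rw [← Finset.sum_div, ← mul_div_assoc, div_le_iff₀ hL']
      refine (average_hits_le hG L _).trans ?_
      rw [mul_comm]
      gcongr
      rwa [div_le_iff₀ hn]
    · simp [sq_nonneg]

/-- The last step of the layered induction. -/
theorem measureReal_highBins_nonempty_le (hL : 0 < L) (hLn : 3 * L ≤ Fintype.card V) (h : ℕ)
    (γ : ℝ) {l : ℝ} (hl : 0 ≤ l) :
    (inputLaw G 2).real {ω |
      ((restarts hG L ω (Fintype.card V)).card : ℝ) ≤ 3 * ((Fintype.card V : ℝ) / L + 1) ∧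
      ((highBins (load τ (walk hG L ω) (Fintype.card V)) h).card : ℝ) ≤ γ * Fintype.card V ∧
      (highBins (load τ (walk hG L ω) (Fintype.card V)) (h + 1)).Nonempty} ≤
      Real.exp (-(l - 4 * Real.exp l * γ ^ 2 * Fintype.card V)) := by
  classical
  have := isProbabilityMeasure_inputLaw hG
  have hn : (0 : ℝ) < Fintype.card V := card_pos_real
  have hL' : (0 : ℝ) < L := Nat.cast_pos.2 hL
  have hLn' : 3 * (L : ℝ) ≤ Fintype.card V := by exact_mod_cast hLn
  -- A single hit must now be excluded, so each epoch counts as `0` or `1` without division by `L`,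
  -- and a large tilt `l` makes one hit costly.
  refine le_trans (measureReal_mono ?_) (measureReal_sum_restarts_le hG (L := L)
    (g := fun r ω p =>
      if ((highBins (load τ (walk hG L ω) r) h).card : ℝ) ≤ γ * Fintype.card V then
        ((min (hits hG L (highBins (load τ (walk hG L ω) r) h) p) 1 : ℕ) : ℝ) else 0)
    (q := L * γ ^ 2) (fun _ _ p => by positivity) ?_ ?_ ?_ hl (Fintype.card V) _)
  · rintro ω ⟨hR, hh, hh'⟩
    simp only [Set.mem_ofPred_eq]
    have h1 := card_highBins_succ_le_sum_hits hG (ω := ω) hL τ h (Fintype.card V)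
    change _ ≤ ∑ r ∈ restarts hG L ω _, _ at h1
    have h2 : (1 : ℝ) ≤ ∑ r ∈ restarts hG L ω (Fintype.card V),
        (if ((highBins (load τ (walk hG L ω) r) h).card : ℝ) ≤ γ * Fintype.card V then
          ((min (hits hG L (highBins (load τ (walk hG L ω) r) h) (ω r).1) 1 : ℕ) : ℝ)
          else 0) := by
      obtain ⟨r, hr, hr'⟩ := Finset.exists_ne_zero_of_sum_ne_zero
        (hh'.card_pos.trans_le h1).ne'
      refine le_trans ?_ (Finset.single_le_sum (fun r _ => by positivity) hr)
      have hr2 := hr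
      rw [restarts, Finset.mem_filter, Finset.mem_range] at hr2
      rw [if_pos, min_eq_right (Nat.one_le_iff_ne_zero.2 hr'), Nat.cast_one]
      refine le_trans ?_ hh
      exact_mod_cast Finset.card_le_card (highBins_mono_time τ _ h hr2.1.le)
    have h4 : (1 : ℝ) ≤ Fintype.card V / L / 3 := by
      rw [div_div, one_le_div (by positivity)]
      linarith
    have h5 : (Real.exp l - 1) * (L * γ ^ 2) * (restarts hG L ω (Fintype.card V)).card ≤
        Real.exp l * (L * γ ^ 2) * (4 * (Fintype.card V / L)) := by
      gcongr
      · linarith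
      · linarith
    have h6 : Real.exp l * (L * γ ^ 2) * (4 * (Fintype.card V / L)) =
        4 * Real.exp l * γ ^ 2 * Fintype.card V := by
      field_simp
    have h7 := mul_le_mul_of_nonneg_left h2 hl
    linarith
  · intro r ω p
    split_ifs
    · exact_mod_cast min_le_right _ _
    · exact zero_le_one
  · intro t p ω ω' hω
    simp only [load_walk_congr hG τ fun s hs => hω s hs]
  · intro t ω
    split_ifs with hc
    · refine le_trans ?_
        ((average_hits_le hG L (highBins (load τ (walk hG L ω) t) h)).trans ?_)
      · gcongr
        exact min_le_left _ _
      · gcongr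
        rwa [div_le_iff₀ hn]
    · simp only [Finset.sum_const_zero, mul_zero]
      positivity

/-- The layered induction. -/
theorem measureReal_lt_maxLoad_le (hL : 0 < L)
    (hinj : ∀ (e : G.Dart) (i k : ℕ), i < k → k < L → headAt hG e i ≠ headAt hG e k)
    (hLn : 6 * L ^ 2 ≤ Fintype.card V) {γ : ℕ → ℝ} (hγ : ∀ i, 0 ≤ γ i)
    (hγs : ∀ i, γ (i + 1) = 12 * γ i ^ 2) {h : ℕ} (hh : 1 ≤ h * γ 0) (J : ℕ) {l : ℝ}
    (hl : 0 ≤ l) :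
    (inputLaw G 2).real {ω | h + J < maxLoad hG L τ ω} ≤
      Real.exp (-((Fintype.card V : ℝ) / L)) +
      ∑ i ∈ Finset.range J, Real.exp (-(4 * γ i ^ 2 * (Fintype.card V / L))) +
      Real.exp (-(l - 4 * Real.exp l * γ J ^ 2 * Fintype.card V)) := by
  classical
  have := isProbabilityMeasure_inputLaw hG
  have hLn3 : 3 * L ≤ Fintype.card V := by nlinarith
  have hLnr : (6 : ℝ) * L ^ 2 ≤ Fintype.card V := by exact_mod_cast hLn
  have hn : (0 : ℝ) < Fintype.card V := card_pos_real
  set A := {ω : ℕ → Input G 2 | 3 * ((Fintype.card V : ℝ) / L + 1) <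
      (restarts hG L ω (Fintype.card V)).card} with hA
  set B := fun i => {ω : ℕ → Input G 2 |
      ((restarts hG L ω (Fintype.card V)).card : ℝ) ≤ 3 * ((Fintype.card V : ℝ) / L + 1) ∧
      ((highBins (load τ (walk hG L ω) (Fintype.card V)) (h + i)).card : ℝ) ≤
        γ i * Fintype.card V ∧
      12 * γ i ^ 2 * Fintype.card V <
        (highBins (load τ (walk hG L ω) (Fintype.card V)) (h + i + 1)).card} with hB
  set D := {ω : ℕ → Input G 2 |
      ((restarts hG L ω (Fintype.card V)).card : ℝ) ≤ 3 * ((Fintype.card V : ℝ) / L + 1) ∧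
      ((highBins (load τ (walk hG L ω) (Fintype.card V)) (h + J)).card : ℝ) ≤
        γ J * Fintype.card V ∧
      (highBins (load τ (walk hG L ω) (Fintype.card V)) (h + J + 1)).Nonempty} with hD
  have hsub : {ω | h + J < maxLoad hG L τ ω} ⊆ (A ∪ ⋃ i ∈ Finset.range J, B i) ∪ D := by
    intro ω hω
    by_contra hbad
    simp only [Set.mem_union, Set.mem_iUnion, not_or, not_exists] at hbad
    obtain ⟨⟨hnA, hnB⟩, hnD⟩ := hbad
    have hR : ((restarts hG L ω (Fintype.card V)).card : ℝ) ≤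
        3 * ((Fintype.card V : ℝ) / L + 1) := not_lt.1 hnA
    have hind : ∀ i ≤ J, ((highBins (load τ (walk hG L ω) (Fintype.card V)) (h + i)).card : ℝ) ≤
        γ i * Fintype.card V := by
      intro i
      induction i with
      | zero =>
        -- The induction starts from counting balls: at most `n / h` bins have load at least `h`.
        intro _
        have h1 := mul_card_highBins_le τ (walk hG L ω) h (Fintype.card V)
        have h1' : (h : ℝ) * (highBins (load τ (walk hG L ω) (Fintype.card V)) h).card ≤
            Fintype.card V := by exact_mod_cast h1
        calc ((highBins (load τ (walk hG L ω) (Fintype.card V)) (h + 0)).card : ℝ)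
            ≤ (h * γ 0) * (highBins (load τ (walk hG L ω) (Fintype.card V)) h).card :=
              le_mul_of_one_le_left (Nat.cast_nonneg _) hh
          _ = γ 0 * (h * (highBins (load τ (walk hG L ω) (Fintype.card V)) h).card) := by ring
          _ ≤ _ := mul_le_mul_of_nonneg_left h1' (hγ 0)
      | succ i ih =>
        intro hi
        by_contra! hlt
        rw [hγs] at hlt
        exact hnB i (Finset.mem_range.2 hi) ⟨hR, ih (by omega), hlt⟩
    refine hnD ⟨hR, hind J le_rfl, ?_⟩
    have hω : h + J < maxLoad hG L τ ω := hω
    rw [maxLoad, Finset.lt_sup_iff] at hω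
    obtain ⟨v, -, hv⟩ := hω
    exact ⟨v, by simpa [highBins] using hv⟩
  refine (measureReal_mono hsub).trans ((measureReal_union_le _ _).trans ?_)
  refine add_le_add ((measureReal_union_le _ _).trans (add_le_add ?_ ?_)) ?_
  · exact measureReal_card_restarts_le hG hL hinj hLnr
  · refine (measureReal_biUnion_finset_le _ _).trans (Finset.sum_le_sum fun i _ => ?_)
    exact measureReal_highBins_succ_le hG τ hL hLn3 (h + i) (γ i)
  · exact measureReal_highBins_nonempty_le hG τ hL hLn3 (h + J) (γ J) hl

end MaxLoad

/-! ### Trajectories on the cycle -/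

section Cycle

/-- On a cycle a walker keeps its direction. -/
theorem headAt_cycleGraph {n : ℕ} [NeZero n] (hn : 3 ≤ n) (e : (cycleGraph n).Dart) (i : ℕ) :
    headAt (cycleGraph_regular hn) e i = e.snd + i • (e.snd - e.fst) := by
  have step : ∀ e : (cycleGraph n).Dart, (nextDart (cycleGraph_regular hn) e).snd =
      e.snd + (e.snd - e.fst) := by
    intro e
    obtain ⟨m, rfl⟩ := Nat.exists_eq_add_of_le' hn
    have h1 := e.adj
    have h2 := (nextDart (cycleGraph_regular hn) e).adj
    have h3 := nextDart_snd_ne (cycleGraph_regular hn) e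
    rw [nextDart_fst] at h2
    rw [cycleGraph_adj] at h1 h2
    have h3' : (nextDart (cycleGraph_regular hn) e).snd - e.snd ≠ e.fst - e.snd :=
      fun h => h3 (sub_left_injective h)
    rw [← sub_eq_iff_eq_add']
    rcases h1 with h1 | h1 <;> rcases h2 with h2 | h2
    · rw [← neg_sub, h2, ← neg_sub, h1]
    · exact absurd (h2.trans h1.symm) h3'
    · exact absurd (by rw [← neg_sub, h2, ← neg_sub, h1]) h3'
    · rw [h2, h1]
  have hdir : ∀ i, ((nextDart (cycleGraph_regular hn))^[i] e).snd -
      ((nextDart (cycleGraph_regular hn))^[i] e).fst = e.snd - e.fst := by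
    intro i
    induction i with
    | zero => rfl
    | succ i ih =>
      rw [Function.iterate_succ_apply', nextDart_fst, step, add_sub_cancel_left, ih]
  induction i with
  | zero => simp [headAt]
  | succ i ih =>
    rw [headAt] at ih ⊢
    rw [Function.iterate_succ_apply', step, hdir, ih, succ_nsmul, add_assoc]

/-- The two positions differ by `k - i` steps of `±1`, and `0 < k - i < n`. -/
theorem headAt_cycleGraph_ne {n : ℕ} (hn : 3 ≤ n) (e : (cycleGraph n).Dart) {i k : ℕ}
    (hik : i < k) (hk : k < n) :
    headAt (cycleGraph_regular hn) e i ≠ headAt (cycleGraph_regular hn) e k := by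
  have : NeZero n := ⟨by omega⟩
  rw [headAt_cycleGraph hn, headAt_cycleGraph hn]
  obtain ⟨j, rfl⟩ := Nat.exists_eq_add_of_lt hik
  obtain ⟨m, rfl⟩ := Nat.exists_eq_add_of_le' hn
  intro h
  rw [add_assoc i, add_nsmul, ← add_assoc, left_eq_add] at h
  have hone : (j + 1) • (1 : Fin (m + 3)) ≠ 0 := by
    have hval : ∀ l, l < m + 3 → (l • (1 : Fin (m + 3))).val = l := by
      intro l
      induction l with
      | zero => simp
      | succ l ih =>
        intro hl
        rw [succ_nsmul, Fin.val_add, ih (by omega), Fin.val_one, Nat.mod_eq_of_lt hl]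
    intro h0
    have := hval (j + 1) (by omega)
    rw [h0] at this
    simp at this
  have h1 := e.adj
  rw [cycleGraph_adj] at h1
  rcases h1 with h1 | h1
  · rw [← neg_sub, h1, smul_neg, neg_eq_zero] at h
    exact hone h
  · rw [h1] at h
    exact hone h

end Cycle

/-! ### Choice of parameters and limits -/

section Asymptotics

theorem measureReal_lt_maxLoad_cycleGraph_le {n : ℕ} (hn : 3 ≤ n) (hx : 25 ≤ Real.log n)
    (τ : TieRule (cycleGraph n)) :
    (inputLaw (cycleGraph n) 2).real {ω | Real.logb 2 (Real.log n) + 90 ≤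
      maxLoad (cycleGraph_regular hn) ⌊(n : ℝ) ^ (0.4 : ℝ)⌋₊ τ ω} ≤
      Real.exp (-Real.exp (0.6 * Real.log n)) +
      Real.log n * Real.exp (-(Real.exp (0.04 * Real.log n) / 36)) +
      Real.exp (1 - 0.1 * Real.log n) := by
  have : NeZero n := ⟨by omega⟩
  have hn0 : (0 : ℝ) < n := by positivity
  have hpow : ∀ a : ℝ, (n : ℝ) ^ a = Real.exp (a * Real.log n) := fun a => by
    rw [Real.rpow_def_of_pos hn0, mul_comm]
  set L := ⌊(n : ℝ) ^ (0.4 : ℝ)⌋₊ with hLdef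
  set x := Real.log n with hxdef
  have hexp : Real.exp x = n := Real.exp_log hn0
  have hLle : (L : ℝ) ≤ Real.exp (0.4 * x) := by
    rw [← hpow]
    exact Nat.floor_le (by positivity)
  have hL : 0 < L := by
    rw [hLdef, Nat.floor_pos, hpow]
    exact Real.one_le_exp (by positivity)
  have hL' : (0 : ℝ) < L := Nat.cast_pos.2 hL
  have hLn : 6 * L ^ 2 ≤ n := by
    have h1 : (6 : ℝ) ≤ Real.exp (0.2 * x) := by
      have := Real.add_one_le_exp (0.2 * x)
      linarith
    have h2 : (6 : ℝ) * L ^ 2 ≤ n := by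
      calc (6 : ℝ) * L ^ 2 ≤ Real.exp (0.2 * x) * Real.exp (0.4 * x) ^ 2 := by gcongr
        _ = Real.exp x := by
          rw [← Real.exp_nat_mul, ← Real.exp_add]
          congr 1
          push_cast
          ring
        _ = n := hexp
    exact_mod_cast h2
  have hnL : Real.exp (0.6 * x) ≤ n / L := by
    rw [le_div_iff₀ hL']
    calc Real.exp (0.6 * x) * L ≤ Real.exp (0.6 * x) * Real.exp (0.4 * x) := by gcongr
      _ = n := by
        rw [← Real.exp_add, ← hexp]
        congr 1
        ring
  -- The last density is `exp (-y) / 12`. A factor above `0.5` makes its square times `n` vanish;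
  -- one below `0.6` lets the Chernoff exponents at earlier levels, at least `exp (0.6 * x - y) /
  -- 36`, grow.
  set y := 0.56 * x with hy
  have hy1 : 1 ≤ y := by linarith
  set J := ⌊Real.logb 2 y⌋₊ with hJ
  have hJle : (J : ℝ) ≤ Real.logb 2 y := Nat.floor_le (Real.logb_nonneg one_lt_two hy1)
  have h2J : (2 : ℝ) ^ J ≤ y := by
    have := (Real.le_logb_iff_rpow_le one_lt_two (by linarith)).1 hJle
    rwa [Real.rpow_natCast] at this
  have h2J' : y < 2 * 2 ^ J := by
    have h1 : Real.logb 2 y < (J + 1 : ℕ) := by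
      push_cast
      exact Nat.lt_floor_add_one _
    have := (Real.logb_lt_iff_lt_rpow one_lt_two (by linarith)).1 h1
    rwa [Real.rpow_natCast, pow_succ, mul_comm] at this
  have h2Jpos : (0 : ℝ) < 2 ^ J := by positivity
  -- `θ` absorbs the rounding of `J`, so that `θ * 2 ^ J` is exactly `y`.
  set θ := y / 2 ^ J with hθ
  have hθ2 : θ ≤ 2 := by
    rw [hθ, div_le_iff₀ h2Jpos]
    exact h2J'.le
  have hθ0 : 0 ≤ θ := by positivity
  have hθJ : θ * 2 ^ J = y := div_mul_cancel₀ _ h2Jpos.ne'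
  have hJx : (J : ℝ) ≤ x := by
    have h1 : (J : ℝ) ≤ 2 ^ J := by exact_mod_cast Nat.lt_two_pow_self.le
    linarith
  -- The initial level must satisfy `h ≥ 12 * exp θ`; since `θ ≤ 2` and `12 * exp 2 < 89`, the
  -- choice `h = 89` works.
  have key := measureReal_lt_maxLoad_le (cycleGraph_regular hn) τ hL
    (fun e i k hik hk => headAt_cycleGraph_ne hn e hik
      (hk.trans_le (by nlinarith)))
    (by rwa [Fintype.card_fin]) (γ := fun i => Real.exp (-(θ * 2 ^ i)) / 12)
    (fun i => by positivity) (fun i => by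
      rw [div_pow, ← Real.exp_nat_mul, pow_succ]
      rw [show ((2 : ℕ) : ℝ) * -(θ * 2 ^ i) = -(θ * (2 ^ i * 2)) by push_cast; ring]
      ring) (h := 89) (by
      have h1 : Real.exp (-2) ≤ Real.exp (-(θ * 2 ^ 0)) := by
        apply Real.exp_le_exp.2
        linarith
      have h2 : Real.exp 2 ≤ 89 / 12 := by
        have h3 := Real.exp_one_lt_d9
        rw [show (2 : ℝ) = 1 + 1 by norm_num, Real.exp_add]
        nlinarith [Real.exp_pos 1]
      have h4 : (12 : ℝ) / 89 ≤ Real.exp (-2) := by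
        rw [Real.exp_neg, ← inv_div]
        exact inv_anti₀ (Real.exp_pos 2) h2
      have h5 := h4.trans h1
      push_cast
      linear_combination (89 / 12 : ℝ) * h5) J (l := 0.1 * x) (by positivity)
  have hprob := isProbabilityMeasure_inputLaw (cycleGraph_regular hn)
  refine (measureReal_mono fun ω hω => ?_).trans (key.trans ?_)
  · simp only [Set.mem_ofPred_eq] at hω ⊢
    have h1 : Real.logb 2 y ≤ Real.logb 2 x :=
      Real.logb_le_logb_of_le one_lt_two (by linarith) (by linarith)
    have h2 : ((89 + J : ℕ) : ℝ) < maxLoad (cycleGraph_regular hn) L τ ω := by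
      push_cast
      linarith
    exact_mod_cast h2
  · rw [Fintype.card_fin]
    refine add_le_add (add_le_add ?_ ?_) ?_
    · exact Real.exp_le_exp.2 (neg_le_neg hnL)
    · refine (Finset.sum_le_card_nsmul _ _ (Real.exp (-(Real.exp (0.04 * x) / 36)))
        fun i hi => ?_).trans ?_
      · apply Real.exp_le_exp.2
        apply neg_le_neg
        -- The worst level is `i = J - 1`.
        have h1 : θ * 2 ^ i * 2 ≤ y := by
          rw [← hθJ, mul_assoc, ← pow_succ]
          gcongr
          · exact one_le_two
          · exact Finset.mem_range.1 hi
        calc Real.exp (0.04 * x) / 36 = Real.exp (-y) / 36 * Real.exp (0.6 * x) := by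
              rw [div_mul_eq_mul_div, ← Real.exp_add, hy]
              congr 2
              ring
          _ ≤ Real.exp (-(θ * 2 ^ i * 2)) / 36 * (n / L) := by gcongr
          _ = _ := by
              rw [div_pow, ← Real.exp_nat_mul]
              rw [show ((2 : ℕ) : ℝ) * -(θ * 2 ^ i) = -(θ * 2 ^ i * 2) by push_cast; ring]
              ring
      · rw [Finset.card_range, nsmul_eq_mul]
        gcongr
    · apply Real.exp_le_exp.2
      rw [hθJ]
      -- The exponents add up to `0.1 - 2 * 0.56 + 1 = -0.02`.
      have h1 : 4 * Real.exp (0.1 * x) * (Real.exp (-y) / 12) ^ 2 * n =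
          Real.exp (-(0.02 * x)) / 36 := by
        rw [← hexp, div_pow, ← Real.exp_nat_mul]
        rw [show -(0.02 * x) = 0.1 * x + ((2 : ℕ) : ℝ) * -y + x by push_cast; rw [hy]; ring,
          Real.exp_add, Real.exp_add]
        ring
      have h2 : Real.exp (-(0.02 * x)) ≤ 1 := Real.exp_le_one_iff.2 (by linarith)
      rw [h1]
      linarith

theorem tendsto_failure_bound :
    Filter.Tendsto (fun x : ℝ => Real.exp (-Real.exp (0.6 * x)) +
      x * Real.exp (-(Real.exp (0.04 * x) / 36)) + Real.exp (1 - 0.1 * x))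
      Filter.atTop (nhds 0) := by
  have hlin : ∀ a : ℝ, 0 < a → Filter.Tendsto (fun x : ℝ => a * x) Filter.atTop Filter.atTop :=
    fun a ha => Filter.tendsto_id.const_mul_atTop ha
  have h1 : Filter.Tendsto (fun x : ℝ => Real.exp (-Real.exp (0.6 * x))) Filter.atTop (nhds 0) :=
    Real.tendsto_exp_neg_atTop_nhds_zero.comp
      (Real.tendsto_exp_atTop.comp (hlin 0.6 (by norm_num)))
  have h2 : Filter.Tendsto (fun x : ℝ => x * Real.exp (-(Real.exp (0.04 * x) / 36)))
      Filter.atTop (nhds 0) := by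
    have h3 : Filter.Tendsto (fun x : ℝ => Real.exp (0.04 * x) / 36) Filter.atTop Filter.atTop :=
      (Real.tendsto_exp_atTop.comp (hlin 0.04 (by norm_num))).atTop_div_const (by norm_num)
    -- Here `x ≤ 25 * exp (0.04 * x) = 900 * (exp (0.04 * x) / 36)`.
    have h4 := ((Real.tendsto_pow_mul_exp_neg_atTop_nhds_zero 1).comp h3).const_mul 900
    rw [mul_zero] at h4
    refine squeeze_zero' ?_ ?_ h4
    · filter_upwards [Filter.eventually_ge_atTop 0] with x hx
      positivity
    · filter_upwards with x
      have := Real.add_one_le_exp (0.04 * x)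
      rw [Function.comp_apply, pow_one, ← mul_assoc]
      gcongr
      linarith
  have h5 : Filter.Tendsto (fun x : ℝ => Real.exp (1 - 0.1 * x)) Filter.atTop (nhds 0) := by
    refine Real.tendsto_exp_atBot.comp ?_
    have := Filter.tendsto_neg_atTop_atBot.comp (hlin 0.1 (by norm_num))
    exact Filter.tendsto_atBot_add_const_left _ 1 this
  simpa using (h1.add h2).add h5

end Asymptotics

end RandomWalkAllocation

theorem mainTheorem6 :
    ∃ C : ℝ, ∀ ε : ℝ, 0 < ε → ∃ N : ℕ, ∀ n : ℕ, N ≤ n → ∀ hn : 3 ≤ n,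
      ∀ c : ℝ, c * Real.log n = ⌊(n : ℝ) ^ (0.4 : ℝ)⌋ →
      ∀ τ : RandomWalkAllocation.TieRule (SimpleGraph.cycleGraph n),
        1 - ε ≤ (RandomWalkAllocation.inputLaw (SimpleGraph.cycleGraph n) 2).real
          {ω | (RandomWalkAllocation.maxLoad (RandomWalkAllocation.cycleGraph_regular hn)
            ⌊c * Real.log n⌋₊ τ ω : ℝ) < Real.logb 2 (Real.log n) + C} := by
  open RandomWalkAllocation in
  refine ⟨90, fun ε hε => ?_⟩
  have hlog : Filter.Tendsto (fun n : ℕ => Real.log n) Filter.atTop Filter.atTop :=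
    Real.tendsto_log_atTop.comp tendsto_natCast_atTop_atTop
  obtain ⟨N, hN⟩ := Filter.eventually_atTop.1
    (((tendsto_failure_bound.comp hlog).eventually (gt_mem_nhds hε)).and
      (hlog.eventually_ge_atTop 25))
  refine ⟨N, fun n hNn hn c hc τ => ?_⟩
  obtain ⟨hF, hx⟩ := hN n hNn
  have hfloor : ⌊c * Real.log n⌋₊ = ⌊(n : ℝ) ^ (0.4 : ℝ)⌋₊ := by
    rw [hc, ← natCast_floor_eq_intCast_floor (by positivity), Nat.floor_natCast]
  have : NeZero n := ⟨by omega⟩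
  have hprob := isProbabilityMeasure_inputLaw (cycleGraph_regular hn)
  have hbad := measureReal_lt_maxLoad_cycleGraph_le hn hx τ
  rw [hfloor]
  -- Subadditivity replaces the complement rule, so measurability of the event is not needed.
  have hcover := measureReal_union_le (μ := inputLaw (cycleGraph n) 2)
    {ω | (maxLoad (cycleGraph_regular hn) ⌊(n : ℝ) ^ (0.4 : ℝ)⌋₊ τ ω : ℝ) <
      Real.logb 2 (Real.log n) + 90}
    {ω | Real.logb 2 (Real.log n) + 90 ≤
      maxLoad (cycleGraph_regular hn) ⌊(n : ℝ) ^ (0.4 : ℝ)⌋₊ τ ω}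
  have huniv : {ω | (maxLoad (cycleGraph_regular hn) ⌊(n : ℝ) ^ (0.4 : ℝ)⌋₊ τ ω : ℝ) <
      Real.logb 2 (Real.log n) + 90} ∪ {ω | Real.logb 2 (Real.log n) + 90 ≤
      (maxLoad (cycleGraph_regular hn) ⌊(n : ℝ) ^ (0.4 : ℝ)⌋₊ τ ω : ℝ)} = Set.univ :=
    Set.eq_univ_of_forall fun ω =>
      lt_or_ge (maxLoad (cycleGraph_regular hn) ⌊(n : ℝ) ^ (0.4 : ℝ)⌋₊ τ ω : ℝ) _
  rw [huniv, probReal_univ] at hcover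
  simp only [Function.comp_apply] at hF
  linarith
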